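/- Let $0<a\le 1$ and let $\zeta(s,a)$ be the Hurwitz zeta function, i.e. the analytic continuation of $\sum_{n\ge 0}(n+a)^{-s}$ ($\Re s>1$) to $\mathbb{C}\setminus\{1\}$, with a simple pole of residue $1$ at $s=1$. The function $(s-1)\zeta(s,a)$ is understood as an entire function of $s$, with value $1$ at $s=1$. Put $$\psi(t)=\frac{te^{t}}{(e^{t}-1)^2}-\frac{1}{e^{t}-1}+\frac{(a-1)t}{e^{t}-1},\qquad S_n(s,a)=\sum_{k=0}^{n-1}(-1)^k\binom{n-1}{k}(k+a)^{-s}\quad(n\ge 1).$$ For $0<\varepsilon<2\pi$ let $\mathcal{C}$ be the Hankel contour of radius $\varepsilon$: it runs from $-\infty$ to $-\varepsilon$ along the lower side of the negative real axis (where $\arg t=-\pi$), counterclockwise around the circle $|t|=\varepsilon$ (with $\arg t$ running from $-\pi$ to $\pi$), and from $-\varepsilon$ back to $-\infty$ along the upper side (where $\arg t=\pi$); on it $t^{s-1}=e^{(s-1)(\log|t|+i\arg t)}$. Then: (C) For every $s\in\mathbb{C}$ the integral $\int_{\mathcal{C}}\psi(-t)e^{(a-1)t}t^{s-1}\,dt$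 converges absolutely, and $$(s-1)\zeta(s,a)=\frac{\Gamma(1-s)}{2\pi i}\int_{\mathcal{C}}\psi(-t)e^{(a-1)t}t^{s-1}\,dt ;$$ at $s=1,2,3,\dots$, where $\Gamma(1-s)$ has a pole, the right-hand side is understood as its limit as $s$ tends to that point. (D) For every $s\in\mathbb{C}$ the following series converges absolutely, and $$(s-1)\zeta(s,a)=\sum_{n=1}^{\infty}S_n(s,a)\left(\frac{1}{n+1}+\frac{a-1}{n}\right).$$ -/

import Mathlib

open Complex Set Filter Topology MeasureTheory

noncomputable section

/-- The function `s ↦ (s - 1) ζ(s, a)`, with the removable singularity at `s = 1` filled in: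
the Hurwitz zeta function has a simple pole with residue `1` there. -/
def subOneMulHurwitz (a : ℝ) (s : ℂ) : ℂ :=
  if s = 1 then 1 else (s - 1) * HurwitzZeta.hurwitzZeta (a : UnitAddCircle) s

/-- For `Re s > 1` the Hurwitz zeta function is the series `∑ (n + a)⁻ˢ`, `n ≥ 0`. -/
theorem subOneMulHurwitz_of_one_lt_re {a : ℝ} (ha : 0 < a) (ha1 : a ≤ 1) {s : ℂ} (hs : 1 < s.re) :
    subOneMulHurwitz a s = (s - 1) * ∑' n : ℕ, 1 / ((n : ℂ) + a) ^ s := by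
  have h1 : s ≠ 1 := by
    rintro rfl
    simp at hs
  rw [subOneMulHurwitz, if_neg h1,
    (HurwitzZeta.hasSum_hurwitzZeta_of_one_lt_re ⟨ha.le, ha1⟩ hs).tsum_eq]

/-- The function `(s - 1) ζ(s, a)`, so completed at `s = 1`, is entire. -/
theorem differentiable_subOneMulHurwitz (a : ℝ) : Differentiable ℂ (subOneMulHurwitz a) := by
  have key : ∀ s : ℂ, s ≠ 1 → DifferentiableAt ℂ (subOneMulHurwitz a) s := by
    intro s hs
    have h : DifferentiableAt ℂ
        (fun z : ℂ => (z - 1) * HurwitzZeta.hurwitzZeta (a : UnitAddCircle) z) s :=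
      (differentiableAt_id.sub_const 1).mul (HurwitzZeta.differentiableAt_hurwitzZeta _ hs)
    refine h.congr_of_eventuallyEq ?_
    filter_upwards [isOpen_ne.mem_nhds hs] with z hz
    simp [subOneMulHurwitz, if_neg (show z ≠ 1 from hz)]
  have hc : ContinuousAt (subOneMulHurwitz a) 1 := by
    rw [continuousAt_iff_punctured_nhds]
    have h := HurwitzZeta.hurwitzZeta_residue_one (a : UnitAddCircle)
    have h1 : subOneMulHurwitz a 1 = 1 := if_pos rfl
    rw [h1]
    refine h.congr' ?_
    filter_upwards [self_mem_nhdsWithin] with z hz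
    simp [subOneMulHurwitz, if_neg (show z ≠ 1 from hz)]
  have hd := (differentiableOn_compl_singleton_and_continuousAt_iff
    (s := (univ : Set ℂ)) (c := 1) univ_mem).1
    ⟨fun z hz => (key z hz.2).differentiableWithinAt, hc⟩
  exact fun s => hd.differentiableAt univ_mem

/-- The alternating sum `S_n(s, a) = ∑_{k=0}^{n-1} (-1)^k (n-1 choose k) (k + a)^{-s}`, `n ≥ 1`. -/
def altSum (n : ℕ) (s : ℂ) (a : ℝ) : ℂ :=
  ∑ k ∈ Finset.range n, (-1) ^ k * ((n - 1).choose k : ℂ) * ((k : ℂ) + a) ^ (-s)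

/-- The function `ψ(t) = t e^t / (e^t - 1)^2 - 1 / (e^t - 1) + (a - 1) t / (e^t - 1)`, for complex
`t` outside `2πiℤ`. -/
def psiFun (a : ℝ) (t : ℂ) : ℂ :=
  t * exp t / (exp t - 1) ^ 2 - 1 / (exp t - 1) + ((a : ℂ) - 1) * t / (exp t - 1)

/-- The value of the integrand `g(t) t^{s-1}` at the point `t = r e^{iθ}`, with the branch
`arg t = θ` of the power. Along the Hankel contour, `θ` runs from `-π` to `π`. -/
def branchIntegrand (g : ℂ → ℂ) (s : ℂ) (r θ : ℝ) : ℂ :=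
  g (r * exp (θ * I)) * exp ((s - 1) * ((Real.log r : ℂ) + θ * I))

/-- Absolute convergence of `∫_C g(t) t^{s-1} dt` along each of the three parts of the Hankel
contour with radius `ε`. -/
def HankelIntegrable (g : ℂ → ℂ) (s : ℂ) (ε : ℝ) : Prop :=
  IntegrableOn (fun r : ℝ => branchIntegrand g s r (-Real.pi)) (Ioi ε) ∧
  IntervalIntegrable (fun θ : ℝ => branchIntegrand g s ε θ * (ε * exp (θ * I) * I)) volume
    (-Real.pi) Real.pi ∧
  IntegrableOn (fun r : ℝ => branchIntegrand g s r Real.pi) (Ioi ε)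

/-- The integral `∫_C g(t) t^{s-1} dt` along the Hankel contour: from `-∞` to `-ε` on the lower
side of the negative real axis (`t = r e^{-iπ}`, `dt = -dr`, `r` decreasing from `∞` to `ε`), then
counterclockwise along the circle `|t| = ε` (`t = ε e^{iθ}`), then from `-ε` back to `-∞` on the
upper side (`t = r e^{iπ}`, `dt = -dr`, `r` increasing from `ε` to `∞`). -/
def hankelIntegral (g : ℂ → ℂ) (s : ℂ) (ε : ℝ) : ℂ :=
  (∫ r in Ioi ε, branchIntegrand g s r (-Real.pi)) +
  (∫ θ in (-Real.pi)..Real.pi, branchIntegrand g s ε θ * (ε * exp (θ * I) * I)) -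
  (∫ r in Ioi ε, branchIntegrand g s r Real.pi)

/-- The expression `Γ(1-s) / (2πi) ∫_C ψ(-t) e^{(a-1)t} t^{s-1} dt`. -/
def hankelRepr (a : ℝ) (ε : ℝ) (s : ℂ) : ℂ :=
  Gamma (1 - s) / (2 * Real.pi * I) *
    hankelIntegral (fun t => psiFun a (-t) * exp (((a : ℂ) - 1) * t)) s ε

end

/-! The kernel `ψ(-t) e^{(a-1)t}` is the derivative of `B(t) = t e^{at} / (e^t - 1)`. A geometric
series gives `Γ(s+1) ζ(s+1, a)` as the Mellin transform of `B(-r)`, so integration by parts gives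
`Γ(s) (s-1) ζ(s, a)` as that of the kernel. Shrinking the circle of the Hankel contour turns the
contour integral into `2i sin(πs)` times this Mellin transform, that is, by the reflection formula,
into `2πi (s-1) ζ(s, a) / Γ(1-s)`; both sides are entire, which proves (C).

For (D), expanding `t = log (1 - (1 - e^t))` in powers of `1 - e^t` writes the kernel as the series
of `(1/(n+2) + (a-1)/(n+1)) e^{at} (1 - e^t)^n`, and by the binomial theorem the Mellin transform of
`e^{at} (1 - e^t)^n` is `Γ(s) S_{n+1}(s, a)`. The series may be integrated term by term, over the
half-line if `Re s > 0` and over the Hankel contour if `Re s ≤ 0`: as `|1 - e^t| ≤ 1 - e^{-r}` on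
the contour, with `r = -t` on the negative axis and `r = 1` on a small circle, the partial sums are
controlled by `∑ (1 - e^{-r})^n / (n+1) = r / (1 - e^{-r}) ≤ 1 + r`. -/

section TermwiseIntegration

variable {α ι E : Type*} [MeasurableSpace α] {μ : Measure α} [Countable ι]

theorem hasSum_integral_of_norm_sum_le [NormedAddCommGroup E] [NormedSpace ℝ E]
    {F : ι → α → E} {f : α → E} {bound : α → ℝ} (hF : ∀ i, AEStronglyMeasurable (F i) μ)
    (hbound : Integrable bound μ) (hle : ∀ T : Finset ι, ∀ᵐ x ∂μ, ‖∑ i ∈ T, F i x‖ ≤ bound x)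
    (hsum : ∀ᵐ x ∂μ, HasSum (fun i => F i x) (f x)) :
    HasSum (fun i => ∫ x, F i x ∂μ) (∫ x, f x ∂μ) := by
  have hint : ∀ i, Integrable (F i) μ := fun i =>
    hbound.mono' (hF i) (by simpa using hle {i})
  have htends := tendsto_integral_filter_of_dominated_convergence (l := atTop)
    (F := fun (T : Finset ι) x => ∑ i ∈ T, F i x) bound
    (Eventually.of_forall fun T => (integrable_finsetSum T fun i _ => hint i).1)
    (Eventually.of_forall hle) hbound hsum
  simpa only [HasSum, SummationFilter.unconditional_filter,
    integral_finsetSum _ fun i _ => hint i] using htends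

theorem hasSum_setIntegral_mul_of_norm_sum_le {𝕜 : Type*} [RCLike 𝕜] {F : ι → α → 𝕜}
    {f M w : α → 𝕜} {S : Set α} (hS : MeasurableSet S)
    (hF : ∀ i, AEStronglyMeasurable (fun x => F i x * w x) (μ.restrict S))
    (hM : IntegrableOn (fun x => M x * w x) S μ)
    (hle : ∀ x ∈ S, ∀ T : Finset ι, ‖∑ i ∈ T, F i x‖ ≤ ‖M x‖)
    (hsum : ∀ x ∈ S, HasSum (fun i => F i x) (f x)) :
    HasSum (fun i => ∫ x in S, F i x * w x ∂μ) (∫ x in S, f x * w x ∂μ) := by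
  refine hasSum_integral_of_norm_sum_le hF hM.norm (fun T => ?_) ?_
  · filter_upwards [ae_restrict_mem hS] with x hx
    rw [← Finset.sum_mul, norm_mul, norm_mul]
    exact mul_le_mul_of_nonneg_right (hle x hx T) (norm_nonneg _)
  · filter_upwards [ae_restrict_mem hS] with x hx
    exact (hsum x hx).mul_right (w x)

theorem hasSum_mellin_of_norm_sum_le {F : ι → ℝ → ℂ} {f M : ℝ → ℂ} {s : ℂ}
    (hF : ∀ i, ContinuousOn (F i) (Ioi 0)) (hM : MellinConvergent M s)
    (hle : ∀ r > 0, ∀ T : Finset ι, ‖∑ i ∈ T, F i r‖ ≤ ‖M r‖)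
    (hsum : ∀ r > 0, HasSum (fun i => F i r) (f r)) :
    HasSum (fun i => mellin (F i) s) (mellin f s) := by
  simp only [MellinConvergent, mellin, smul_eq_mul, mul_comm _ (F _ _), mul_comm _ (f _),
    mul_comm _ (M _)] at hM ⊢
  refine hasSum_setIntegral_mul_of_norm_sum_le measurableSet_Ioi (fun i => ?_) hM hle hsum
  refine ContinuousOn.aestronglyMeasurable ((hF i).mul fun r hr => ?_) measurableSet_Ioi
  exact (continuousAt_ofReal_cpow_const r (s - 1) (Or.inr (ne_of_gt hr))).continuousWithinAt

end TermwiseIntegration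

section TruncatedMellin

variable {E : Type*} [NormedAddCommGroup E] {f : ℝ → E} {b ε : ℝ}

theorem locallyIntegrableOn_indicator_Ioi (hf : LocallyIntegrableOn f (Ioi 0)) (ε : ℝ) :
    LocallyIntegrableOn ((Ioi ε).indicator f) (Ioi 0) := fun x hx =>
  let ⟨u, hu, hi⟩ := hf x hx
  ⟨u, hu, hi.indicator measurableSet_Ioi⟩

theorem isBigO_indicator_Ioi_of_isBigO_atTop {g : ℝ → ℝ} (hf : f =O[atTop] g) (ε : ℝ) :
    (Ioi ε).indicator f =O[atTop] g :=
  (Asymptotics.isBigO_of_le _ fun _ => norm_indicator_le_norm_self _ _).trans hf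

theorem indicator_Ioi_isBigO_nhdsGT_zero (f : ℝ → E) (hε : 0 < ε) (g : ℝ → ℝ) :
    (Ioi ε).indicator f =O[𝓝[>] 0] g := by
  refine Asymptotics.IsBigO.of_bound 0 ?_
  filter_upwards [nhdsWithin_le_nhds (Iio_mem_nhds hε)] with r (hr : r < ε)
  rw [indicator_of_notMem (notMem_Ioi.2 hr.le), norm_zero, zero_mul]

variable [NormedSpace ℂ E]

theorem cpow_smul_indicator_Ioi (f : ℝ → E) (ε : ℝ) (s : ℂ) :
    (fun r : ℝ => (r : ℂ) ^ (s - 1) • (Ioi ε).indicator f r) =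
      (Ioi ε).indicator fun r : ℝ => (r : ℂ) ^ (s - 1) • f r :=
  (indicator_smul (Ioi ε) (fun r : ℝ => (r : ℂ) ^ (s - 1)) f).symm

theorem mellin_indicator_Ioi (f : ℝ → E) (hε : 0 ≤ ε) (s : ℂ) :
    mellin ((Ioi ε).indicator f) s = ∫ r in Ioi ε, (r : ℂ) ^ (s - 1) • f r := by
  rw [mellin, cpow_smul_indicator_Ioi, setIntegral_indicator measurableSet_Ioi,
    inter_eq_right.2 (Ioi_subset_Ioi hε)]

theorem mellinConvergent_indicator_Ioi (f : ℝ → E) (hε : 0 ≤ ε) (s : ℂ) :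
    MellinConvergent ((Ioi ε).indicator f) s ↔
      IntegrableOn (fun r : ℝ => (r : ℂ) ^ (s - 1) • f r) (Ioi ε) := by
  rw [MellinConvergent, cpow_smul_indicator_Ioi, integrableOn_indicator_iff measurableSet_Ioi,
    inter_eq_left.2 (Ioi_subset_Ioi hε)]

theorem integrableOn_Ioi_cpow_smul (hb : 0 < b) (hf : LocallyIntegrableOn f (Ioi 0))
    (hdecay : f =O[atTop] fun r => Real.exp (-b * r)) (hε : 0 < ε) (s : ℂ) :
    IntegrableOn (fun r : ℝ => (r : ℂ) ^ (s - 1) • f r) (Ioi ε) :=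
  (mellinConvergent_indicator_Ioi f hε.le s).1 <|
    mellinConvergent_of_isBigO_rpow_exp hb (locallyIntegrableOn_indicator_Ioi hf ε)
      (isBigO_indicator_Ioi_of_isBigO_atTop hdecay ε) (indicator_Ioi_isBigO_nhdsGT_zero f hε _)
      (sub_one_lt s.re)

theorem differentiable_setIntegral_Ioi_cpow_smul (hb : 0 < b) (hf : LocallyIntegrableOn f (Ioi 0))
    (hdecay : f =O[atTop] fun r => Real.exp (-b * r)) (hε : 0 < ε) :
    Differentiable ℂ fun s : ℂ => ∫ r in Ioi ε, (r : ℂ) ^ (s - 1) • f r := by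
  simp only [← mellin_indicator_Ioi f hε.le]
  exact fun s => mellin_differentiableAt_of_isBigO_rpow_exp hb
    (locallyIntegrableOn_indicator_Ioi hf ε) (isBigO_indicator_Ioi_of_isBigO_atTop hdecay ε)
    (indicator_Ioi_isBigO_nhdsGT_zero f hε _) (sub_one_lt s.re)

end TruncatedMellin

theorem differentiable_intervalIntegral_mul_exp {k φ : ℝ → ℂ} (hk : Continuous k)
    (hφ : Continuous φ) (a b : ℝ) :
    Differentiable ℂ fun z : ℂ => ∫ θ in a..b, k θ * exp (z * φ θ) := by
  intro z₀
  obtain ⟨C, hC⟩ := ((isCompact_closedBall z₀ 1).prod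
    (isCompact_uIcc (a := a) (b := b))).exists_bound_of_continuousOn
    (f := fun p : ℂ × ℝ => k p.2 * (exp (p.1 * φ p.2) * φ p.2)) (by fun_prop)
  refine (intervalIntegral.hasDerivAt_integral_of_dominated_loc_of_deriv_le
    (F' := fun z θ => k θ * (exp (z * φ θ) * φ θ)) (bound := fun _ => C)
    (Metric.closedBall_mem_nhds z₀ one_pos) ?_ ?_ ?_ ?_ ?_ ?_).2.differentiableAt
  · exact Eventually.of_forall fun z => Continuous.aestronglyMeasurable (by fun_prop)
  · exact Continuous.intervalIntegrable (by fun_prop) _ _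
  · exact Continuous.aestronglyMeasurable (by fun_prop)
  · exact Eventually.of_forall fun θ hθ z hz => hC (z, θ) ⟨hz, uIoc_subset_uIcc hθ⟩
  · exact intervalIntegrable_const
  · exact Eventually.of_forall fun θ _ z _ =>
      (hasDerivAt_mul_const (φ θ)).cexp.const_mul (k θ)

theorem exp_ofReal_neg_pi_mul_I : exp (((-Real.pi : ℝ) : ℂ) * I) = -1 := by
  rw [ofReal_neg, neg_mul, exp_neg_pi_mul_I]

theorem branchIntegrand_of_exp_eq_neg_one (g : ℂ → ℂ) (s : ℂ) {r θ : ℝ} (hr : 0 < r)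
    (hθ : exp (θ * I) = -1) :
    branchIntegrand g s r θ = exp ((s - 1) * (θ * I)) * ((r : ℂ) ^ (s - 1) • g (-(r : ℂ))) := by
  rw [branchIntegrand, hθ, cpow_def_of_ne_zero (ofReal_ne_zero.2 hr.ne'), ← ofReal_log hr.le,
    smul_eq_mul, ← mul_assoc, ← exp_add, mul_comm, mul_neg_one]
  ring_nf

theorem setIntegral_branchIntegrand_of_exp_eq_neg_one (g : ℂ → ℂ) (s : ℂ) {ε θ : ℝ} (hε : 0 ≤ ε)
    (hθ : exp (θ * I) = -1) :
    ∫ r in Ioi ε, branchIntegrand g s r θ =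
      exp ((s - 1) * (θ * I)) * ∫ r in Ioi ε, (r : ℂ) ^ (s - 1) • g (-(r : ℂ)) := by
  rw [← integral_const_mul]
  exact setIntegral_congr_fun measurableSet_Ioi fun r hr =>
    branchIntegrand_of_exp_eq_neg_one g s (hε.trans_lt hr) hθ

theorem norm_branchIntegrand (g : ℂ → ℂ) (s : ℂ) {r : ℝ} (hr : 0 < r) (θ : ℝ) :
    ‖branchIntegrand g s r θ‖ =
      ‖g (r * exp (θ * I))‖ * (r ^ (s.re - 1) * Real.exp (-(s.im * θ))) := by
  rw [branchIntegrand, norm_mul, norm_exp, Real.rpow_def_of_pos hr, ← Real.exp_add]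
  simp [mul_comm, sub_eq_add_neg]

theorem norm_ofReal_mul_exp {r : ℝ} (hr : 0 ≤ r) (θ : ℝ) : ‖(r : ℂ) * exp (θ * I)‖ = r := by
  rw [norm_mul, norm_exp_ofReal_mul_I, mul_one, norm_real, Real.norm_of_nonneg hr]

theorem differentiableAt_Gamma_of_re_pos {s : ℂ} (hs : 0 < s.re) : DifferentiableAt ℂ Gamma s :=
  differentiableAt_Gamma s fun m => ne_of_apply_ne re <| by
    rw [neg_re, natCast_re]
    exact ((neg_nonpos.2 m.cast_nonneg).trans_lt hs).ne'

theorem sin_pi_mul_mul_Gamma {s : ℂ} (hs : Gamma s ≠ 0) :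
    sin (Real.pi * s) * Gamma s = Real.pi / Gamma (1 - s) := by
  have hreflect := Gamma_mul_Gamma_one_sub s
  by_cases hsin : sin (Real.pi * s) = 0
  · rw [hsin, div_zero] at hreflect
    rw [hsin, (mul_eq_zero.1 hreflect).resolve_left hs, zero_mul, div_zero]
  · rw [eq_div_iff hsin] at hreflect
    have hG : Gamma (1 - s) ≠ 0 := by
      intro hG
      rw [hG, mul_zero, zero_mul] at hreflect
      exact Real.pi_ne_zero (ofReal_eq_zero.1 hreflect.symm)
    rw [eq_div_iff hG]
    linear_combination hreflect

theorem hankelIntegral_eq_sin_mul_add (g : ℂ → ℂ) (s : ℂ) {ε : ℝ} (hε : 0 ≤ ε) :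
    hankelIntegral g s ε =
      2 * I * sin (Real.pi * s) * (∫ r in Ioi ε, (r : ℂ) ^ (s - 1) • g (-(r : ℂ))) +
      ∫ θ in (-Real.pi)..Real.pi, branchIntegrand g s ε θ * (ε * exp (θ * I) * I) := by
  have hlower : exp ((s - 1) * (((-Real.pi : ℝ) : ℂ) * I)) = -exp (-(Real.pi * s) * I) := by
    rw [ofReal_neg, show (s - 1) * (-(Real.pi : ℂ) * I) = -(Real.pi * s) * I + Real.pi * I by ring,
      exp_add, exp_pi_mul_I, mul_neg_one]
  have hupper : exp ((s - 1) * (Real.pi * I)) = -exp (Real.pi * s * I) := by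
    rw [show (s - 1) * (Real.pi * I) = Real.pi * s * I - Real.pi * I by ring, exp_sub,
      exp_pi_mul_I, div_neg, div_one]
  rw [hankelIntegral, setIntegral_branchIntegrand_of_exp_eq_neg_one g s hε exp_ofReal_neg_pi_mul_I,
    setIntegral_branchIntegrand_of_exp_eq_neg_one g s hε exp_pi_mul_I, hlower, hupper, Complex.sin]
  linear_combination (exp (Real.pi * s * I) - exp (-(Real.pi * s) * I)) *
    (∫ r in Ioi ε, (r : ℂ) ^ (s - 1) • g (-(r : ℂ))) * I_sq

/-- The functions `g` whose Hankel integrals behave like that of Riemann's `1 / (e ^ (-t) - 1)`: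
holomorphic on the punctured disc of radius `R`, of order `‖t‖ ^ (-c)` at the origin, and
continuous and of exponential decay at rate `b` on the negative axis. -/
structure HankelAdmissible (g : ℂ → ℂ) (R b c : ℝ) : Prop where
  pos : 0 < b
  differentiableOn : DifferentiableOn ℂ g (Metric.ball 0 R \ {0})
  continuousOn : ContinuousOn (fun r : ℝ => g (-(r : ℂ))) (Ioi 0)
  decay : (fun r : ℝ => g (-(r : ℂ))) =O[atTop] fun r => Real.exp (-b * r)
  isBigO_zero : g =O[𝓝[≠] 0] fun t => ‖t‖ ^ (-c)

/-- The integrand `g(t) t ^ (s - 1) dt` in the coordinate `w` with `t = exp w`, in which every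
branch of the power is the same entire function. -/
noncomputable def logIntegrand (g : ℂ → ℂ) (s w : ℂ) : ℂ :=
  g (exp w) * exp ((s - 1) * w) * exp w

theorem logIntegrand_log_add (g : ℂ → ℂ) (s : ℂ) {r : ℝ} (hr : 0 < r) (θ : ℝ) :
    logIntegrand g s (Real.log r + θ * I) = branchIntegrand g s r θ * (r * exp (θ * I)) := by
  have hexp : exp ((Real.log r : ℂ) + θ * I) = r * exp (θ * I) := by
    rw [exp_add, ← ofReal_exp, Real.exp_log hr]
  rw [logIntegrand, branchIntegrand, hexp]

theorem I_smul_integral_logIntegrand (g : ℂ → ℂ) (s : ℂ) {r : ℝ} (hr : 0 < r) :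
    I • (∫ θ : ℝ in (-Real.pi)..Real.pi, logIntegrand g s (Real.log r + θ * I)) =
      ∫ θ in (-Real.pi)..Real.pi, branchIntegrand g s r θ * (r * exp (θ * I) * I) := by
  rw [← intervalIntegral.integral_smul]
  refine intervalIntegral.integral_congr fun θ _ => ?_
  simp only [logIntegrand_log_add g s hr, smul_eq_mul]
  ring

namespace HankelAdmissible

variable {g : ℂ → ℂ} {R b c ε : ℝ} {s : ℂ}

theorem differentiableAt (h : HankelAdmissible g R b c) {t : ℂ} (ht : t ≠ 0) (htR : ‖t‖ < R) :
    DifferentiableAt ℂ g t :=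
  h.differentiableOn.differentiableAt <|
    (Metric.isOpen_ball.sdiff isClosed_singleton).mem_nhds ⟨mem_ball_zero_iff.2 htR, ht⟩

theorem locallyIntegrableOn (h : HankelAdmissible g R b c) :
    LocallyIntegrableOn (fun r : ℝ => g (-(r : ℂ))) (Ioi 0) :=
  h.continuousOn.locallyIntegrableOn measurableSet_Ioi

theorem isBigO_nhdsGT_zero (h : HankelAdmissible g R b c) :
    (fun r : ℝ => g (-(r : ℂ))) =O[𝓝[>] 0] fun r => r ^ (-c) := by
  have hneg : Tendsto (fun r : ℝ => -(r : ℂ)) (𝓝[>] 0) (𝓝[≠] 0) := by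
    refine tendsto_nhdsWithin_iff.2 ⟨?_, ?_⟩
    · exact Tendsto.mono_left (Continuous.tendsto' (by fun_prop) _ _ (by simp)) nhdsWithin_le_nhds
    · filter_upwards [self_mem_nhdsWithin] with r (hr : 0 < r)
      simpa using hr.ne'
  refine (h.isBigO_zero.comp_tendsto hneg).congr' EventuallyEq.rfl ?_
  filter_upwards [self_mem_nhdsWithin] with r (hr : 0 < r)
  rw [Function.comp_apply, norm_neg, norm_real, Real.norm_of_nonneg hr.le]

theorem mellinConvergent (h : HankelAdmissible g R b c) (hs : c < s.re) :
    MellinConvergent (fun r : ℝ => g (-(r : ℂ))) s :=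
  mellinConvergent_of_isBigO_rpow_exp h.pos h.locallyIntegrableOn h.decay h.isBigO_nhdsGT_zero hs

theorem continuous_circle (h : HankelAdmissible g R b c) (hε : 0 < ε) (hεR : ε < R) :
    Continuous fun θ : ℝ => g (ε * exp (θ * I)) := by
  refine h.differentiableOn.continuousOn.comp_continuous (by fun_prop) fun θ => ⟨?_, ?_⟩
  · rwa [mem_ball_zero_iff, norm_ofReal_mul_exp hε.le]
  · exact mul_ne_zero (ofReal_ne_zero.2 hε.ne') (exp_ne_zero _)

theorem integrableOn_branchIntegrand (h : HankelAdmissible g R b c) (hε : 0 < ε) (s : ℂ) {θ : ℝ}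
    (hθ : exp (θ * I) = -1) : IntegrableOn (fun r => branchIntegrand g s r θ) (Ioi ε) :=
  IntegrableOn.congr_fun
    ((integrableOn_Ioi_cpow_smul h.pos h.locallyIntegrableOn h.decay hε s).const_mul _)
    (fun _ hr => (branchIntegrand_of_exp_eq_neg_one g s (hε.trans hr) hθ).symm) measurableSet_Ioi

theorem hankelIntegrable (h : HankelAdmissible g R b c) (hε : 0 < ε) (hεR : ε < R) (s : ℂ) :
    HankelIntegrable g s ε :=
  ⟨h.integrableOn_branchIntegrand hε s exp_ofReal_neg_pi_mul_I,
    Continuous.intervalIntegrable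
      (((h.continuous_circle hε hεR).mul (by fun_prop)).mul (by fun_prop)) _ _,
    h.integrableOn_branchIntegrand hε s exp_pi_mul_I⟩

theorem differentiable_hankelIntegral (h : HankelAdmissible g R b c) (hε : 0 < ε)
    (hεR : ε < R) : Differentiable ℂ fun s => hankelIntegral g s ε := by
  have hray := differentiable_setIntegral_Ioi_cpow_smul h.pos h.locallyIntegrableOn h.decay hε
  have hcircle : Differentiable ℂ fun s : ℂ => ∫ θ in (-Real.pi)..Real.pi,
      branchIntegrand g s ε θ * (ε * exp (θ * I) * I) := by
    simp only [branchIntegrand, mul_right_comm]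
    exact (differentiable_intervalIntegral_mul_exp
      ((h.continuous_circle hε hεR).mul (by fun_prop)) (by fun_prop) _ _).comp
      (differentiable_id.sub_const 1)
  simp only [hankelIntegral_eq_sin_mul_add g _ hε.le]
  fun_prop

theorem differentiableOn_logIntegrand (h : HankelAdmissible g R b c) (hε : 0 < ε) (hεR : ε < R)
    (s : ℂ) : DifferentiableOn ℂ (logIntegrand g s) {w | w.re ≤ Real.log ε} := by
  intro w hw
  have hnorm : ‖exp w‖ < R := by
    rw [norm_exp]
    exact ((Real.le_log_iff_exp_le hε).1 hw).trans_lt hεR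
  have hg : DifferentiableAt ℂ (fun w => g (exp w)) w :=
    (h.differentiableAt (exp_ne_zero w) hnorm).comp w differentiableAt_exp
  exact ((hg.mul (by fun_prop)).mul (by fun_prop)).differentiableWithinAt

theorem integral_logIntegrand_of_exp_eq_neg_one (h : HankelAdmissible g R b c) {δ : ℝ}
    (hδ : 0 < δ) (hδε : δ ≤ ε) (s : ℂ) {θ : ℝ} (hθ : exp (θ * I) = -1) :
    ∫ x : ℝ in (Real.log δ)..(Real.log ε), logIntegrand g s (x + θ * I) =
      (∫ r in Ioi ε, branchIntegrand g s r θ) - ∫ r in Ioi δ, branchIntegrand g s r θ := by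
  have hpos : Real.exp '' uIcc (Real.log δ) (Real.log ε) ⊆ Ioi 0 :=
    image_subset_iff.2 fun x _ => Real.exp_pos x
  have hcont : ContinuousOn (fun r => branchIntegrand g s r θ) (Ioi 0) := by
    have hg : ContinuousOn (fun r : ℝ => g (r * exp (θ * I))) (Ioi 0) := by
      simpa only [hθ, mul_neg_one] using h.continuousOn
    have hlog : ContinuousOn Real.log (Ioi 0) := Real.continuousOn_log.mono fun r hr => ne_of_gt hr
    exact hg.mul (by fun_prop)
  have hsubst := intervalIntegral.integral_deriv_smul_comp'' (a := Real.log δ) (b := Real.log ε)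
    (f := Real.exp) (f' := Real.exp) (g := fun r => branchIntegrand g s r θ) (by fun_prop)
    (fun x _ => (Real.hasDerivAt_exp x).hasDerivWithinAt) (by fun_prop) (hcont.mono hpos)
  rw [Real.exp_log hδ, Real.exp_log (hδ.trans_le hδε), ← intervalIntegral.integral_Ioi_sub_Ioi
    (h.integrableOn_branchIntegrand hδ s hθ) hδε] at hsubst
  rw [← neg_sub, ← hsubst, ← intervalIntegral.integral_neg]
  refine intervalIntegral.integral_congr fun x _ => ?_
  have hx := logIntegrand_log_add g s (Real.exp_pos x) θ
  rw [Real.log_exp, hθ] at hx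
  simp only [hx, Function.comp_apply, real_smul]
  ring

theorem hankelIntegral_eq_of_le (h : HankelAdmissible g R b c) {δ : ℝ} (hδ : 0 < δ) (hδε : δ ≤ ε)
    (hεR : ε < R) (s : ℂ) : hankelIntegral g s δ = hankelIntegral g s ε := by
  have hε : 0 < ε := hδ.trans_le hδε
  have hlog : Real.log δ ≤ Real.log ε := Real.log_le_log hδ hδε
  have hcauchy := integral_boundary_rect_eq_zero_of_differentiableOn (logIntegrand g s)
    ⟨Real.log δ, -Real.pi⟩ ⟨Real.log ε, Real.pi⟩
    ((h.differentiableOn_logIntegrand hε hεR s).mono fun w hw => by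
      rw [mem_reProdIm, uIcc_of_le hlog] at hw
      exact hw.1.2)
  simp only [h.integral_logIntegrand_of_exp_eq_neg_one hδ hδε s exp_ofReal_neg_pi_mul_I,
    h.integral_logIntegrand_of_exp_eq_neg_one hδ hδε s exp_pi_mul_I,
    I_smul_integral_logIntegrand g s hδ, I_smul_integral_logIntegrand g s hε] at hcauchy
  rw [hankelIntegral, hankelIntegral]
  linear_combination -hcauchy

theorem tendsto_circle_integral (h : HankelAdmissible g R b c) (hs : c < s.re) :
    Tendsto (fun δ : ℝ => ∫ θ in (-Real.pi)..Real.pi,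
      branchIntegrand g s δ θ * (δ * exp (θ * I) * I)) (𝓝[>] 0) (𝓝 0) := by
  obtain ⟨C, hC0, hC⟩ := h.isBigO_zero.exists_nonneg
  obtain ⟨ρ, hρ, hball⟩ := Metric.mem_nhdsWithin_iff.1 hC.bound
  have hlim : Tendsto (fun δ : ℝ => C * Real.exp (|s.im| * Real.pi) * δ ^ (s.re - c) *
      |Real.pi - -Real.pi|) (𝓝[>] 0) (𝓝 0) := by
    have hpow := (Real.continuousAt_rpow_const 0 (s.re - c) (Or.inr (by linarith))).tendsto
    rw [Real.zero_rpow (by linarith)] at hpow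
    simpa using ((hpow.mono_left nhdsWithin_le_nhds).const_mul _).mul_const |Real.pi - -Real.pi|
  refine squeeze_zero_norm' ?_ hlim
  filter_upwards [self_mem_nhdsWithin, nhdsWithin_le_nhds (Iio_mem_nhds hρ)] with δ (hδ : 0 < δ) hδρ
  refine intervalIntegral.norm_integral_le_of_norm_le_const fun θ hθ => ?_
  rw [uIoc_of_le (by linarith [Real.pi_pos])] at hθ
  have hz := norm_ofReal_mul_exp hδ.le θ
  have hg : ‖g (δ * exp (θ * I))‖ ≤ C * δ ^ (-c) := by
    have hbound : ‖g (δ * exp (θ * I))‖ ≤ C * ‖‖(δ : ℂ) * exp (θ * I)‖ ^ (-c)‖ :=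
      hball ⟨by rwa [mem_ball_zero_iff, hz],
        mul_ne_zero (ofReal_ne_zero.2 hδ.ne') (exp_ne_zero _)⟩
    rwa [hz, Real.norm_of_nonneg (by positivity)] at hbound
  have harg : -(s.im * θ) ≤ |s.im| * Real.pi := by
    refine (neg_le_abs _).trans ?_
    rw [abs_mul]
    exact mul_le_mul_of_nonneg_left (abs_le.2 ⟨hθ.1.le, hθ.2⟩) (abs_nonneg _)
  calc ‖branchIntegrand g s δ θ * (δ * exp (θ * I) * I)‖
      = ‖g (δ * exp (θ * I))‖ * (δ ^ (s.re - 1) * Real.exp (-(s.im * θ))) * δ := by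
        rw [norm_mul, norm_branchIntegrand g s hδ, norm_mul _ I, hz, norm_I, mul_one]
    _ ≤ C * δ ^ (-c) * (δ ^ (s.re - 1) * Real.exp (|s.im| * Real.pi)) * δ := by gcongr
    _ = C * Real.exp (|s.im| * Real.pi) * (δ ^ (-c) * δ ^ (s.re - 1) * δ ^ (1 : ℝ)) := by
        rw [Real.rpow_one]; ring
    _ = C * Real.exp (|s.im| * Real.pi) * δ ^ (s.re - c) := by
        rw [← Real.rpow_add hδ, ← Real.rpow_add hδ]; ring_nf

theorem hankelIntegral_eq_sin_mul_mellin (h : HankelAdmissible g R b c) (hε : 0 < ε)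
    (hεR : ε < R) (hs : c < s.re) :
    hankelIntegral g s ε = 2 * I * sin (Real.pi * s) * mellin (fun r : ℝ => g (-(r : ℂ))) s := by
  have hray : Tendsto (fun δ : ℝ => ∫ r in Ioi δ, (r : ℂ) ^ (s - 1) • g (-(r : ℂ))) (𝓝[>] 0)
      (𝓝 (mellin (fun r : ℝ => g (-(r : ℂ))) s)) :=
    (h.mellinConvergent hs).continuousWithinAt_Ici_primitive_Ioi.tendsto.mono_left
      (nhdsWithin_mono _ Ioi_subset_Ici_self)
  have hlim := (hray.const_mul (2 * I * sin (Real.pi * s))).add (h.tendsto_circle_integral hs)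
  rw [add_zero] at hlim
  refine tendsto_nhds_unique (tendsto_const_nhds.congr' ?_) hlim
  filter_upwards [self_mem_nhdsWithin, nhdsWithin_le_nhds (Iio_mem_nhds hε)]
    with δ (hδ : 0 < δ) (hδε : δ < ε)
  rw [← hankelIntegral_eq_sin_mul_add g s hδ.le, h.hankelIntegral_eq_of_le hδ hδε.le hεR]

theorem mellin_eq_Gamma_mul (h : HankelAdmissible g R b c) {Z : ℂ → ℂ} (hZ : Differentiable ℂ Z)
    {σ : ℝ} (hM : ∀ s : ℂ, σ < s.re → mellin (fun r : ℝ => g (-(r : ℂ))) s = Gamma s * Z s)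
    (hs : c < s.re) (hs0 : 0 < s.re) :
    mellin (fun r : ℝ => g (-(r : ℂ))) s = Gamma s * Z s := by
  let U : Set ℂ := {z | max c 0 < z.re}
  have hU : IsOpen U := isOpen_lt continuous_const continuous_re
  have hmellin : DifferentiableOn ℂ (mellin fun r : ℝ => g (-(r : ℂ))) U := fun z hz =>
    (mellin_differentiableAt_of_isBigO_rpow_exp h.pos h.locallyIntegrableOn h.decay
      h.isBigO_nhdsGT_zero ((le_max_left _ _).trans_lt hz)).differentiableWithinAt
  have hGamma : DifferentiableOn ℂ (fun z => Gamma z * Z z) U := fun z hz =>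
    ((differentiableAt_Gamma_of_re_pos ((le_max_right _ _).trans_lt hz)).mul
      hZ.differentiableAt).differentiableWithinAt
  obtain ⟨x, hx⟩ := exists_gt (max (max c 0) σ)
  rw [max_lt_iff] at hx
  refine (hmellin.analyticOnNhd hU).eqOn_of_preconnected_of_eventuallyEq
    (hGamma.analyticOnNhd hU) (convex_halfSpace_re_gt _).isPreconnected (z₀ := (x : ℂ)) hx.1 ?_
    (max_lt hs hs0)
  filter_upwards [(isOpen_lt continuous_const continuous_re).mem_nhds hx.2] with z hz
  exact hM z hz

/-- Both sides are entire in `s`, so it suffices to compare them in a half-plane, where the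
reflection formula turns `sin (π s) Γ(s)` into `π / Γ(1 - s)`. -/
theorem hankelIntegral_eq_div_Gamma (h : HankelAdmissible g R b c) (hε : 0 < ε) (hεR : ε < R)
    {Z : ℂ → ℂ} (hZ : Differentiable ℂ Z) {σ : ℝ}
    (hM : ∀ s : ℂ, σ < s.re → mellin (fun r : ℝ => g (-(r : ℂ))) s = Gamma s * Z s) (s : ℂ) :
    hankelIntegral g s ε = 2 * Real.pi * I * Z s / Gamma (1 - s) := by
  have hrhs : Differentiable ℂ fun s : ℂ => 2 * Real.pi * I * Z s / Gamma (1 - s) :=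
    (hZ.const_mul _).mul (differentiable_one_div_Gamma.comp (differentiable_id.const_sub 1))
  obtain ⟨x, hx⟩ := exists_gt (max (max c 0) σ)
  simp only [max_lt_iff] at hx
  refine congrFun (AnalyticOnNhd.eq_of_eventuallyEq (z₀ := (x : ℂ))
    ((h.differentiable_hankelIntegral hε hεR).differentiableOn.analyticOnNhd isOpen_univ)
    (hrhs.differentiableOn.analyticOnNhd isOpen_univ) ?_) s
  filter_upwards [(isOpen_lt continuous_const continuous_re).mem_nhds hx.1.1,
    (isOpen_lt continuous_const continuous_re).mem_nhds hx.1.2,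
    (isOpen_lt continuous_const continuous_re).mem_nhds hx.2] with z hzc hz0 hzσ
  rw [h.hankelIntegral_eq_sin_mul_mellin hε hεR hzc, hM z hzσ]
  linear_combination 2 * I * Z z * sin_pi_mul_mul_Gamma (Gamma_ne_zero_of_re_pos hz0)

end HankelAdmissible

/-- The points `r * exp (θ * I)` at which the integrand of `hankelIntegral g s ε` evaluates `g`. -/
def hankelPath (ε : ℝ) : Set ℂ :=
  Metric.sphere 0 ε ∪ (fun r : ℝ => -(r : ℂ)) '' Ioi ε

section TermwiseHankel

variable {ι : Type*} [Countable ι] {F : ι → ℂ → ℂ} {g M : ℂ → ℂ} {s : ℂ} {ε : ℝ}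

theorem hasSum_setIntegral_branchIntegrand_of_norm_sum_le (hε : 0 ≤ ε)
    (hF : ∀ i, ContinuousOn (F i) (hankelPath ε))
    (hle : ∀ t ∈ hankelPath ε, ∀ T : Finset ι, ‖∑ i ∈ T, F i t‖ ≤ ‖M t‖)
    (hsum : ∀ t ∈ hankelPath ε, HasSum (fun i => F i t) (g t)) {θ : ℝ} (hθ : exp (θ * I) = -1)
    (hM : IntegrableOn (fun r => branchIntegrand M s r θ) (Ioi ε)) :
    HasSum (fun i => ∫ r in Ioi ε, branchIntegrand (F i) s r θ)
      (∫ r in Ioi ε, branchIntegrand g s r θ) := by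
  have hpath : MapsTo (fun r : ℝ => (r : ℂ) * exp (θ * I)) (Ioi ε) (hankelPath ε) := fun r hr =>
    Or.inr ⟨r, hr, by simp only [hθ, mul_neg_one]⟩
  have hlog : ContinuousOn Real.log (Ioi ε) :=
    Real.continuousOn_log.mono fun r hr => (hε.trans_lt hr).ne'
  exact hasSum_setIntegral_mul_of_norm_sum_le measurableSet_Ioi
    (fun i => ContinuousOn.aestronglyMeasurable
      (((hF i).comp (by fun_prop) hpath).mul (by fun_prop)) measurableSet_Ioi)
    hM (fun r hr => hle _ (hpath hr)) fun r hr => hsum _ (hpath hr)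

theorem hasSum_circle_integral_of_norm_sum_le (hε : 0 ≤ ε)
    (hF : ∀ i, ContinuousOn (F i) (hankelPath ε))
    (hle : ∀ t ∈ hankelPath ε, ∀ T : Finset ι, ‖∑ i ∈ T, F i t‖ ≤ ‖M t‖)
    (hsum : ∀ t ∈ hankelPath ε, HasSum (fun i => F i t) (g t))
    (hM : IntervalIntegrable (fun θ : ℝ => branchIntegrand M s ε θ * (ε * exp (θ * I) * I)) volume
      (-Real.pi) Real.pi) :
    HasSum (fun i => ∫ θ in (-Real.pi)..Real.pi,
        branchIntegrand (F i) s ε θ * (ε * exp (θ * I) * I))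
      (∫ θ in (-Real.pi)..Real.pi, branchIntegrand g s ε θ * (ε * exp (θ * I) * I)) := by
  have hpath (θ : ℝ) : (ε : ℂ) * exp (θ * I) ∈ hankelPath ε :=
    Or.inl (mem_sphere_zero_iff_norm.2 (norm_ofReal_mul_exp hε θ))
  have hpi : -Real.pi ≤ Real.pi := neg_le_self Real.pi_pos.le
  simp only [intervalIntegral.integral_of_le hpi, intervalIntegrable_iff_integrableOn_Ioc_of_le hpi,
    branchIntegrand, mul_assoc (F _ _), mul_assoc (g _), mul_assoc (M _)] at hM ⊢
  exact hasSum_setIntegral_mul_of_norm_sum_le measurableSet_Ioc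
    (fun i => Continuous.aestronglyMeasurable
      (((hF i).comp_continuous (by fun_prop) hpath).mul (by fun_prop)))
    hM (fun θ _ => hle _ (hpath θ)) fun θ _ => hsum _ (hpath θ)

theorem hasSum_hankelIntegral_of_norm_sum_le (hε : 0 ≤ ε)
    (hF : ∀ i, ContinuousOn (F i) (hankelPath ε)) (hM : HankelIntegrable M s ε)
    (hle : ∀ t ∈ hankelPath ε, ∀ T : Finset ι, ‖∑ i ∈ T, F i t‖ ≤ ‖M t‖)
    (hsum : ∀ t ∈ hankelPath ε, HasSum (fun i => F i t) (g t)) :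
    HasSum (fun i => hankelIntegral (F i) s ε) (hankelIntegral g s ε) :=
  ((hasSum_setIntegral_branchIntegrand_of_norm_sum_le hε hF hle hsum exp_ofReal_neg_pi_mul_I
    hM.1).add (hasSum_circle_integral_of_norm_sum_le hε hF hle hsum hM.2.1)).sub
    (hasSum_setIntegral_branchIntegrand_of_norm_sum_le hε hF hle hsum exp_pi_mul_I hM.2.2)

end TermwiseHankel

theorem ofReal_cpow_isBigO_rpow (z : ℂ) {l : Filter ℝ} (hl : ∀ᶠ r in l, 0 < r) :
    (fun r : ℝ => (r : ℂ) ^ z) =O[l] fun r => r ^ z.re := by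
  refine Asymptotics.IsBigO.of_bound' ?_
  filter_upwards [hl] with r hr
  rw [norm_cpow_eq_rpow_re_of_pos hr]
  exact le_abs_self _

section MellinDeriv

variable {f f' : ℝ → ℂ} {b c : ℝ} {s : ℂ}

theorem tendsto_cpow_mul_nhdsGT_zero_of_isBigO (hf : f =O[𝓝[>] 0] fun r => r ^ (-c))
    (hc : c < s.re) : Tendsto (fun r : ℝ => (r : ℂ) ^ s * f r) (𝓝[>] 0) (𝓝 0) := by
  have hrpow := (Real.continuousAt_rpow_const 0 (s.re - c) (Or.inr (by linarith))).tendsto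
  rw [Real.zero_rpow (by linarith)] at hrpow
  refine (((ofReal_cpow_isBigO_rpow s self_mem_nhdsWithin).mul hf).congr' EventuallyEq.rfl
    ?_).trans_tendsto (hrpow.mono_left nhdsWithin_le_nhds)
  filter_upwards [self_mem_nhdsWithin] with r (hr : 0 < r)
  rw [← Real.rpow_add hr, sub_eq_add_neg]

theorem tendsto_cpow_mul_atTop_of_isBigO_exp (hb : 0 < b)
    (hf : f =O[atTop] fun r => Real.exp (-b * r)) (s : ℂ) :
    Tendsto (fun r : ℝ => (r : ℂ) ^ s * f r) atTop (𝓝 0) :=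
  ((ofReal_cpow_isBigO_rpow s (eventually_gt_atTop 0)).mul hf).trans_tendsto
    (tendsto_rpow_mul_exp_neg_mul_atTop_nhds_zero s.re b hb)

theorem mellin_deriv_of_isBigO (hb : 0 < b) (hderiv : ∀ r > 0, HasDerivAt f (f' r) r)
    (hdecay : f =O[atTop] fun r => Real.exp (-b * r)) (hzero : f =O[𝓝[>] 0] fun r => r ^ (-c))
    (hc : c < s.re - 1) (hf' : MellinConvergent f' s) :
    mellin f' s = (1 - s) * mellin f (s - 1) := by
  have hcont : ContinuousOn f (Ioi 0) := fun r hr => (hderiv r hr).continuousAt.continuousWithinAt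
  have hre : c < (s - 1).re := by rwa [sub_re, one_re]
  have hmellin : MellinConvergent f (s - 1) := mellinConvergent_of_isBigO_rpow_exp hb
    (hcont.locallyIntegrableOn measurableSet_Ioi) hdecay hzero hre
  have hpow (r : ℝ) (hr : 0 < r) :
      HasDerivAt (fun r : ℝ => (r : ℂ) ^ (s - 1)) ((s - 1) * (r : ℂ) ^ (s - 1 - 1)) r :=
    (hasStrictDerivAt_cpow_const (ofReal_mem_slitPlane.2 hr)).hasDerivAt.comp_ofReal
  have hparts := integral_Ioi_mul_deriv_eq_deriv_mul hpow hderiv hf'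
    (IntegrableOn.congr_fun (hmellin.const_mul (s - 1))
      (fun r _ => (mul_assoc _ _ _).symm) measurableSet_Ioi)
    (tendsto_cpow_mul_nhdsGT_zero_of_isBigO hzero hre)
    (tendsto_cpow_mul_atTop_of_isBigO_exp hb hdecay (s - 1))
  simp only [mul_assoc, integral_const_mul] at hparts
  simp only [mellin, smul_eq_mul, hparts]
  ring

end MellinDeriv

section Expansion

/-- The factor `ψ(-t) e ^ ((a - 1) t)` of the integrand. -/
noncomputable def psiKernel (a : ℝ) (t : ℂ) : ℂ :=
  psiFun a (-t) * exp (((a : ℂ) - 1) * t)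

/-- The generating function `t e ^ (a t) / (e ^ t - 1)` of the Bernoulli polynomials at `a`. -/
noncomputable def bernoulliKernel (a : ℝ) (t : ℂ) : ℂ :=
  t * exp (a * t) / (exp t - 1)

/-- The function `e ^ (a t) (1 - e ^ t) ^ n`; its Mellin transform along the negative axis is the
alternating sum of index `n + 1`. -/
noncomputable def altKernel (a : ℝ) (n : ℕ) (t : ℂ) : ℂ :=
  exp (a * t) * (1 - exp t) ^ n

/-- The coefficient of `altKernel a n` in the expansion of `psiKernel a`. -/
noncomputable def altCoeff (a : ℝ) (n : ℕ) : ℂ :=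
  1 / (((n + 1 : ℕ) : ℂ) + 1) + ((a : ℂ) - 1) / ((n + 1 : ℕ) : ℂ)

variable {a : ℝ} {t : ℂ}

theorem exp_ne_one_of_abs_im_lt (ht : t ≠ 0) (him : |t.im| < 2 * Real.pi) : exp t ≠ 1 := by
  intro hexp
  obtain ⟨n, rfl⟩ := exp_eq_one_iff.1 hexp
  have hn : |(n : ℝ)| < 1 := by
    have him' : |(n : ℝ)| * (2 * Real.pi) < 1 * (2 * Real.pi) := by
      simpa [abs_mul, abs_of_pos Real.pi_pos] using him
    exact lt_of_mul_lt_mul_right him' Real.two_pi_pos.le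
  have hn0 : n = 0 := Int.abs_lt_one_iff.1 (by exact_mod_cast hn)
  exact ht (by simp [hn0])

theorem isOpen_exp_ne_one : IsOpen {t : ℂ | exp t ≠ 1} :=
  isOpen_ne_fun continuous_exp continuous_const

theorem psiKernel_eq (a : ℝ) (ht : exp t ≠ 1) :
    psiKernel a t = exp (a * t) *
      ((t / (exp t - 1) - 1) / (1 - exp t) + (a - 1) * (t / (exp t - 1))) := by
  have hsub : exp t - 1 ≠ 0 := sub_ne_zero.2 ht
  have hsub' : 1 - exp t ≠ 0 := sub_ne_zero.2 ht.symm
  have hneg : exp (-t) - 1 = (1 - exp t) / exp t := by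
    rw [exp_neg, sub_div, div_self (exp_ne_zero t), one_div]
  have hshift : exp (((a : ℂ) - 1) * t) = exp (a * t) / exp t := by
    rw [sub_mul, one_mul, exp_sub]
  rw [psiKernel, psiFun, hneg, hshift, exp_neg]
  field_simp
  ring

theorem hasDerivAt_bernoulliKernel (a : ℝ) (ht : exp t ≠ 1) :
    HasDerivAt (bernoulliKernel a) (psiKernel a t) t := by
  have hsub : exp t - 1 ≠ 0 := sub_ne_zero.2 ht
  have hsub' : 1 - exp t ≠ 0 := sub_ne_zero.2 ht.symm
  have hnum := (hasDerivAt_id t).mul ((hasDerivAt_const_mul (a : ℂ)).cexp (x := t))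
  convert! hnum.div ((hasDerivAt_exp t).sub_const 1) hsub using 1
  rw [psiKernel_eq a ht, id, Pi.mul_apply, id]
  field_simp
  ring

theorem differentiableOn_bernoulliKernel (a : ℝ) :
    DifferentiableOn ℂ (bernoulliKernel a) {t | exp t ≠ 1} := fun _ ht =>
  (hasDerivAt_bernoulliKernel a ht).differentiableAt.differentiableWithinAt

theorem differentiableOn_psiKernel (a : ℝ) :
    DifferentiableOn ℂ (psiKernel a) {t | exp t ≠ 1} :=
  ((differentiableOn_bernoulliKernel a).deriv isOpen_exp_ne_one).congr fun _ ht =>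
    (hasDerivAt_bernoulliKernel a ht).deriv.symm

theorem hasSum_pow_div_succ {z : ℂ} (hz : ‖z‖ < 1) (hz0 : z ≠ 0) :
    HasSum (fun n : ℕ => z ^ n / ((n : ℂ) + 1)) (-log (1 - z) / z) := by
  have hlog := ((hasSum_nat_add_iff' 1).2 (hasSum_taylorSeries_neg_log hz)).div_const z
  simpa only [Finset.range_one, Finset.sum_singleton, Nat.cast_zero, div_zero, sub_zero,
    Nat.cast_add, Nat.cast_one, pow_succ, div_right_comm _ _ z, mul_div_cancel_right₀ _ hz0]
    using hlog

theorem hasSum_one_sub_exp_pow_div_succ (ht : t ≠ 0) (him : |t.im| < Real.pi)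
    (hz : ‖1 - exp t‖ < 1) :
    HasSum (fun n : ℕ => (1 - exp t) ^ n / ((n : ℂ) + 1)) (t / (exp t - 1)) := by
  have hexp : exp t ≠ 1 := exp_ne_one_of_abs_im_lt ht (by linarith [Real.pi_pos])
  have hsum := hasSum_pow_div_succ hz (sub_ne_zero.2 hexp.symm)
  rwa [sub_sub_cancel, log_exp (abs_lt.1 him).1 (abs_lt.1 him).2.le, ← neg_div_neg_eq, neg_neg,
    neg_sub] at hsum

theorem hasSum_altKernel_div_succ (a : ℝ) (ht : t ≠ 0) (him : |t.im| < Real.pi)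
    (hz : ‖1 - exp t‖ < 1) :
    HasSum (fun n : ℕ => 1 / ((n : ℂ) + 1) * altKernel a n t) (bernoulliKernel a t) := by
  convert! (hasSum_one_sub_exp_pow_div_succ ht him hz).mul_left (exp (a * t)) using 1
  · funext n
    rw [altKernel]
    ring
  · rw [bernoulliKernel]
    ring

theorem hasSum_altCoeff_mul_altKernel (a : ℝ) (ht : t ≠ 0) (him : |t.im| < Real.pi)
    (hz : ‖1 - exp t‖ < 1) :
    HasSum (fun n : ℕ => altCoeff a n * altKernel a n t) (psiKernel a t) := by
  have hexp : exp t ≠ 1 := exp_ne_one_of_abs_im_lt ht (by linarith [Real.pi_pos])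
  have hsub : 1 - exp t ≠ 0 := sub_ne_zero.2 hexp.symm
  have hsum := hasSum_one_sub_exp_pow_div_succ ht him hz
  have hshift := ((hasSum_nat_add_iff' 1).2 hsum).div_const (1 - exp t)
  simp only [Finset.range_one, Finset.sum_singleton, pow_zero, Nat.cast_zero, zero_add,
    div_one] at hshift
  rw [psiKernel_eq a hexp]
  convert! (hshift.add (hsum.mul_left ((a : ℂ) - 1))).mul_left (exp (a * t)) using 1
  funext n
  rw [altCoeff, altKernel, pow_succ]
  push_cast
  field_simp

theorem norm_altCoeff_le (a : ℝ) (n : ℕ) : ‖altCoeff a n‖ ≤ (1 + |a - 1|) / ((n : ℝ) + 1) := by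
  have hfirst : ‖(1 : ℂ) / (((n + 1 : ℕ) : ℂ) + 1)‖ ≤ 1 / ((n : ℝ) + 1) := by
    rw [norm_div, norm_one, ← Nat.cast_add_one, norm_natCast]
    push_cast
    gcongr
    linarith
  have hsecond : ‖((a : ℂ) - 1) / ((n + 1 : ℕ) : ℂ)‖ = |a - 1| / ((n : ℝ) + 1) := by
    rw [norm_div, norm_natCast, ← ofReal_one, ← ofReal_sub, norm_real, Real.norm_eq_abs,
      Nat.cast_add_one]
  rw [add_div, ← hsecond]
  exact (norm_add_le _ _).trans (by gcongr)

theorem exp_neg_lt_one {r : ℝ} (hr : 0 < r) : Real.exp (-r) < 1 :=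
  Real.exp_lt_one_iff.2 (neg_lt_zero.2 hr)

theorem norm_one_sub_exp_neg {r : ℝ} (hr : 0 < r) :
    ‖1 - exp (-(r : ℂ))‖ = 1 - Real.exp (-r) := by
  rw [← ofReal_neg, ← ofReal_exp, ← ofReal_one, ← ofReal_sub, norm_real,
    Real.norm_of_nonneg (sub_nonneg.2 (exp_neg_lt_one hr).le)]

theorem hasSum_one_sub_exp_neg_pow_div_succ {r : ℝ} (hr : 0 < r) :
    HasSum (fun n : ℕ => (1 - Real.exp (-r)) ^ n / ((n : ℝ) + 1)) (r / (1 - Real.exp (-r))) := by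
  have hsum := hasSum_one_sub_exp_pow_div_succ (t := -(r : ℂ)) (by simpa using hr.ne')
    (by simpa using Real.pi_pos)
    (by rw [norm_one_sub_exp_neg hr]; exact sub_lt_self _ (Real.exp_pos _))
  rw [← neg_div_neg_eq, neg_neg, neg_sub] at hsum
  exact_mod_cast hsum

theorem div_one_sub_exp_neg_le {r : ℝ} (hr : 0 < r) : r / (1 - Real.exp (-r)) ≤ 1 + r := by
  rw [div_le_iff₀ (sub_pos.2 (exp_neg_lt_one hr))]
  have hexp : (1 + r) * Real.exp (-r) ≤ 1 := by
    rw [Real.exp_neg, ← div_eq_mul_inv, div_le_one (Real.exp_pos r), add_comm]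
    exact Real.add_one_le_exp r
  linarith

theorem norm_sum_mul_altKernel_le {c : ℕ → ℂ} {K : ℝ} (hK : 0 ≤ K)
    (hc : ∀ n, ‖c n‖ ≤ K / ((n : ℝ) + 1)) (a : ℝ) {r : ℝ} (hr : 0 < r)
    (hz : ‖1 - exp t‖ ≤ 1 - Real.exp (-r)) (T : Finset ℕ) :
    ‖∑ n ∈ T, c n * altKernel a n t‖ ≤ K * (1 + r) * ‖exp (a * t)‖ := by
  have hq : 0 ≤ 1 - Real.exp (-r) := sub_nonneg.2 (exp_neg_lt_one hr).le
  calc ‖∑ n ∈ T, c n * altKernel a n t‖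
      ≤ ∑ n ∈ T, K * ‖exp (a * t)‖ * ((1 - Real.exp (-r)) ^ n / ((n : ℝ) + 1)) := by
        refine norm_sum_le_of_le T fun n _ => ?_
        calc ‖c n * altKernel a n t‖ = ‖c n‖ * (‖exp (a * t)‖ * ‖1 - exp t‖ ^ n) := by
              rw [altKernel, norm_mul, norm_mul, norm_pow]
          _ ≤ K / ((n : ℝ) + 1) * (‖exp (a * t)‖ * (1 - Real.exp (-r)) ^ n) := by
              gcongr
              exact hc n
          _ = K * ‖exp (a * t)‖ * ((1 - Real.exp (-r)) ^ n / ((n : ℝ) + 1)) := by ring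
    _ ≤ K * ‖exp (a * t)‖ * (r / (1 - Real.exp (-r))) :=
        sum_le_hasSum T (fun n _ => by positivity)
          ((hasSum_one_sub_exp_neg_pow_div_succ hr).mul_left _)
    _ ≤ K * ‖exp (a * t)‖ * (1 + r) := by
        gcongr
        exact div_one_sub_exp_neg_le hr
    _ = K * (1 + r) * ‖exp (a * t)‖ := by ring

end Expansion

/-- A set of points `t` at which the partial sums of an expansion in the functions `altKernel a n`
are bounded by a multiple of `(1 - t) e ^ (a t)`. The negative axis and a punctured disc around `0`
are contained in it. -/
def expansionRegion : Set ℂ :=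
  {t | t ≠ 0 ∧ |t.im| < Real.pi ∧
    ∃ r : ℝ, 0 < r ∧ ‖1 - exp t‖ ≤ 1 - Real.exp (-r) ∧ 1 + r ≤ 3 * ‖1 - t‖}

/-- The function dominating the partial sums of the expansions in `altKernel a n`, up to a
constant. It is entire, hence itself subject to the theory of Hankel integrals. -/
noncomputable def expMajorant (a C : ℝ) (t : ℂ) : ℂ :=
  C * (1 - t) * exp (a * t)

theorem neg_ofReal_mem_expansionRegion {r : ℝ} (hr : 0 < r) : -(r : ℂ) ∈ expansionRegion := by
  refine ⟨by simpa using hr.ne', by simpa using Real.pi_pos, r, hr, (norm_one_sub_exp_neg hr).le,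
    ?_⟩
  rw [sub_neg_eq_add, ← ofReal_one, ← ofReal_add, norm_real, Real.norm_of_nonneg (by positivity)]
  linarith

theorem mem_expansionRegion_of_norm_le {t : ℂ} (ht : t ≠ 0) (ht4 : ‖t‖ ≤ 1 / 4) :
    t ∈ expansionRegion := by
  refine ⟨ht, by linarith [abs_im_le_norm t, Real.pi_gt_three], 1, one_pos, ?_, ?_⟩
  · have hexp : ‖1 - exp t‖ ≤ 2 * ‖t‖ := by
      rw [norm_sub_rev]
      exact norm_exp_sub_one_le (by linarith)
    linarith [Real.exp_neg_one_lt_half]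
  · have htri : 1 - ‖t‖ ≤ ‖1 - t‖ := by simpa using norm_sub_norm_le 1 t
    linarith

theorem hankelPath_subset_expansionRegion : hankelPath (1 / 4) ⊆ expansionRegion := by
  rintro t (ht | ⟨r, hr, rfl⟩)
  · rw [mem_sphere_zero_iff_norm] at ht
    exact mem_expansionRegion_of_norm_le (norm_pos_iff.1 (by rw [ht]; norm_num)) ht.le
  · exact neg_ofReal_mem_expansionRegion (lt_trans (by norm_num) hr)

theorem norm_one_sub_exp_lt_one {t : ℂ} (ht : t ∈ expansionRegion) : ‖1 - exp t‖ < 1 :=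
  let ⟨_, _, _, _, hz, _⟩ := ht
  hz.trans_lt (sub_lt_self _ (Real.exp_pos _))

section Majorant

variable {a K : ℝ} {c : ℕ → ℂ}

theorem norm_sum_mul_altKernel_le_expMajorant (hK : 0 ≤ K)
    (hc : ∀ n, ‖c n‖ ≤ K / ((n : ℝ) + 1)) (a : ℝ) {t : ℂ} (ht : t ∈ expansionRegion)
    (T : Finset ℕ) : ‖∑ n ∈ T, c n * altKernel a n t‖ ≤ ‖expMajorant a (3 * K) t‖ := by
  obtain ⟨_, _, r, hr, hz, hr3⟩ := ht
  calc ‖∑ n ∈ T, c n * altKernel a n t‖ ≤ K * (1 + r) * ‖exp (a * t)‖ :=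
        norm_sum_mul_altKernel_le hK hc a hr hz T
    _ ≤ K * (3 * ‖1 - t‖) * ‖exp (a * t)‖ := by gcongr
    _ = ‖expMajorant a (3 * K) t‖ := by
        rw [expMajorant, norm_mul, norm_mul, norm_real, Real.norm_of_nonneg (by positivity)]
        ring

theorem hankelAdmissible_of_differentiable {g : ℂ → ℂ} (hg : Differentiable ℂ g) {b : ℝ}
    (hb : 0 < b) (hdecay : (fun r : ℝ => g (-(r : ℂ))) =O[atTop] fun r => Real.exp (-b * r))
    (R : ℝ) : HankelAdmissible g R b 0 where
  pos := hb
  differentiableOn := hg.differentiableOn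
  continuousOn := (hg.continuous.comp (by fun_prop)).continuousOn
  decay := hdecay
  isBigO_zero := by
    simpa only [neg_zero, Real.rpow_zero] using
      ((hg.continuous.tendsto 0).mono_left nhdsWithin_le_nhds).isBigO_one ℝ

theorem hankelAdmissible_expMajorant (ha : 0 < a) (C R : ℝ) :
    HankelAdmissible (expMajorant a C) R (a / 2) 0 := by
  refine hankelAdmissible_of_differentiable (by unfold expMajorant; fun_prop) (half_pos ha) ?_ R
  have hlinear : (fun r : ℝ => 1 + r) =O[atTop] fun r => Real.exp (a / 2 * r) := by
    simpa only [pow_zero, pow_one] using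
      (isLittleO_pow_exp_pos_mul_atTop 0 (half_pos ha)).isBigO.add
        (isLittleO_pow_exp_pos_mul_atTop 1 (half_pos ha)).isBigO
  have hreal := (hlinear.const_mul_left C).mul
    (Asymptotics.isBigO_refl (fun r : ℝ => Real.exp (-a * r)) atTop)
  refine (isBigO_ofReal_left.2 hreal).congr (fun r => ?_) fun r => ?_
  · rw [expMajorant]
    push_cast
    ring_nf
  · rw [← Real.exp_add]
    ring_nf

theorem hankelAdmissible_of_hasSum_altKernel {g : ℂ → ℂ} (ha : 0 < a) (hK : 0 ≤ K)
    (hc : ∀ n, ‖c n‖ ≤ K / ((n : ℝ) + 1)) (hg : DifferentiableOn ℂ g {t | exp t ≠ 1})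
    (hsum : ∀ t ∈ expansionRegion, HasSum (fun n => c n * altKernel a n t) (g t)) :
    HankelAdmissible g (2 * Real.pi) (a / 2) 0 := by
  have hM := hankelAdmissible_expMajorant ha (3 * K) (2 * Real.pi)
  have hle (t : ℂ) (ht : t ∈ expansionRegion) : ‖g t‖ ≤ ‖expMajorant a (3 * K) t‖ :=
    le_of_tendsto' (hsum t ht).norm fun T => norm_sum_mul_altKernel_le_expMajorant hK hc a ht T
  refine ⟨hM.pos, hg.mono ?_, hg.continuousOn.comp (by fun_prop) ?_, ?_, ?_⟩
  · rintro t ⟨ht, ht0⟩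
    exact exp_ne_one_of_abs_im_lt ht0 ((abs_im_le_norm t).trans_lt (mem_ball_zero_iff.1 ht))
  · exact fun r (hr : 0 < r) => exp_ne_one_of_abs_im_lt (by simpa using hr.ne')
      (by simpa using Real.pi_pos)
  · refine Asymptotics.IsBigO.trans (Asymptotics.IsBigO.of_bound' ?_) hM.decay
    filter_upwards [eventually_gt_atTop 0] with r hr
    exact hle _ (neg_ofReal_mem_expansionRegion hr)
  · refine Asymptotics.IsBigO.trans (Asymptotics.IsBigO.of_bound' ?_) hM.isBigO_zero
    filter_upwards [self_mem_nhdsWithin,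
      nhdsWithin_le_nhds (Metric.closedBall_mem_nhds 0 (by norm_num : (0 : ℝ) < 1 / 4))]
      with t ht ht4
    exact hle t (mem_expansionRegion_of_norm_le ht (mem_closedBall_zero_iff.1 ht4))

end Majorant

section Kernels

variable {a : ℝ}

theorem hasSum_psiKernel (a : ℝ) {t : ℂ} (ht : t ∈ expansionRegion) :
    HasSum (fun n => altCoeff a n * altKernel a n t) (psiKernel a t) :=
  hasSum_altCoeff_mul_altKernel a ht.1 ht.2.1 (norm_one_sub_exp_lt_one ht)

theorem hankelAdmissible_psiKernel (ha : 0 < a) :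
    HankelAdmissible (psiKernel a) (2 * Real.pi) (a / 2) 0 :=
  hankelAdmissible_of_hasSum_altKernel ha (by positivity) (norm_altCoeff_le a)
    (differentiableOn_psiKernel a) fun _ => hasSum_psiKernel a

theorem hankelAdmissible_bernoulliKernel (ha : 0 < a) :
    HankelAdmissible (bernoulliKernel a) (2 * Real.pi) (a / 2) 0 := by
  refine hankelAdmissible_of_hasSum_altKernel ha zero_le_one (fun n => ?_)
    (differentiableOn_bernoulliKernel a) fun t ht =>
      hasSum_altKernel_div_succ a ht.1 ht.2.1 (norm_one_sub_exp_lt_one ht)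
  rw [norm_div, norm_one, ← Nat.cast_add_one, norm_natCast, Nat.cast_add_one]

theorem differentiable_altKernel (a : ℝ) (n : ℕ) : Differentiable ℂ (altKernel a n) := by
  unfold altKernel
  fun_prop

theorem hankelAdmissible_const_mul_altKernel (ha : 0 < a) (c : ℂ) (n : ℕ) (R : ℝ) :
    HankelAdmissible (fun t => c * altKernel a n t) R a 0 := by
  refine hankelAdmissible_of_differentiable ((differentiable_altKernel a n).const_mul c) ha
    (Asymptotics.IsBigO.of_bound ‖c‖ ?_) R
  filter_upwards [eventually_gt_atTop 0] with r hr
  have hq : 0 ≤ 1 - Real.exp (-r) := sub_nonneg.2 (exp_neg_lt_one hr).le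
  have hexp : ‖exp (a * -(r : ℂ))‖ = Real.exp (-a * r) := by
    rw [norm_exp]
    simp
  rw [altKernel, norm_mul, norm_mul, norm_pow, norm_one_sub_exp_neg hr, hexp,
    Real.norm_of_nonneg (Real.exp_pos _).le]
  gcongr
  exact mul_le_of_le_one_right (Real.exp_pos _).le
    (pow_le_one₀ hq (sub_le_self _ (Real.exp_pos _).le))

theorem differentiable_altSum (ha : 0 < a) (n : ℕ) : Differentiable ℂ fun s => altSum n s a := by
  refine Differentiable.fun_sum fun k _ => ?_
  have hk : (k : ℂ) + a ≠ 0 := by exact_mod_cast (by positivity : (k : ℝ) + a ≠ 0)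
  exact (differentiable_id.neg.const_cpow (Or.inl hk)).const_mul _

theorem altKernel_neg_eq_sum (a : ℝ) (n : ℕ) (r : ℝ) :
    altKernel a n (-(r : ℂ)) = ∑ k : Fin (n + 1),
      (-1) ^ (k : ℕ) * (n.choose k : ℂ) * Real.exp (-((k : ℕ) + a) * r) := by
  rw [Fin.sum_univ_eq_sum_range (fun k : ℕ =>
      (-1) ^ k * (n.choose k : ℂ) * (Real.exp (-((k : ℝ) + a) * r) : ℂ)),
    altKernel, sub_eq_neg_add, add_pow, Finset.mul_sum]
  refine Finset.sum_congr rfl fun k _ => ?_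
  rw [neg_pow, ← exp_nat_mul, one_pow]
  push_cast
  rw [show -((k : ℂ) + a) * r = a * -r + k * -r by ring, exp_add]
  ring

theorem mellin_altKernel (ha : 0 < a) (n : ℕ) {s : ℂ} (hs : 0 < s.re) :
    mellin (fun r : ℝ => altKernel a n (-(r : ℂ))) s = Gamma s * altSum (n + 1) s a := by
  have hsum := hasSum_mellin (a := fun k : Fin (n + 1) => (-1) ^ (k : ℕ) * (n.choose k : ℂ))
    (p := fun k => (k : ℕ) + a) (F := fun r : ℝ => altKernel a n (-(r : ℂ)))
    (fun k => Or.inr (by positivity)) hs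
    (fun r _ => altKernel_neg_eq_sum a n r ▸ hasSum_fintype _) (hasSum_fintype _).summable
  rw [← hsum.tsum_eq, tsum_fintype, altSum, Finset.mul_sum, Finset.sum_range]
  refine Finset.sum_congr rfl fun k _ => ?_
  rw [cpow_neg, Nat.add_sub_cancel]
  push_cast
  ring

theorem mellin_const_mul_altKernel (ha : 0 < a) (c : ℂ) (n : ℕ) {s : ℂ} (hs : 0 < s.re) :
    mellin (fun r : ℝ => c * altKernel a n (-(r : ℂ))) s =
      Gamma s * (altSum (n + 1) s a * c) := by
  have hconst := mellin_const_smul (fun r : ℝ => altKernel a n (-(r : ℂ))) s c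
  simp only [smul_eq_mul] at hconst
  rw [hconst, mellin_altKernel ha n hs]
  ring

theorem hasSum_exp_neg_div_one_sub_exp_neg (a : ℝ) {r : ℝ} (hr : 0 < r) :
    HasSum (fun k : ℕ => (1 : ℂ) * Real.exp (-((k : ℝ) + a) * r))
      (exp (-(a * r)) / (1 - exp (-(r : ℂ)))) := by
  have hq : ‖exp (-(r : ℂ))‖ < 1 := by
    rw [norm_exp, neg_re, ofReal_re]
    exact exp_neg_lt_one hr
  convert! (hasSum_geometric_of_norm_lt_one hq).mul_left (exp (-(a * r))) using 1
  funext k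
  rw [← exp_nat_mul, ← exp_add]
  push_cast
  ring_nf

theorem mellin_bernoulliKernel (ha : 0 < a) {s : ℂ} (hs : 0 < s.re) :
    mellin (fun r : ℝ => bernoulliKernel a (-(r : ℂ))) s =
      Gamma (s + 1) * ∑' k : ℕ, 1 / ((k : ℂ) + a) ^ (s + 1) := by
  have hre : 1 < (s + 1).re := by
    rw [add_re, one_re]
    linarith
  have hsum : Summable fun k : ℕ => 1 / ((k : ℝ) + a) ^ (s + 1).re :=
    ((Real.summable_one_div_nat_add_rpow a _).2 hre).congr fun k => by
      rw [abs_of_pos (by positivity)]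
  have hmellin := hasSum_mellin (a := fun _ : ℕ => (1 : ℂ)) (p := fun k => (k : ℝ) + a)
    (fun k => Or.inr (by positivity)) (zero_lt_one.trans hre)
    (fun r hr => hasSum_exp_neg_div_one_sub_exp_neg a hr) (by simpa only [norm_one] using hsum)
  calc mellin (fun r : ℝ => bernoulliKernel a (-(r : ℂ))) s
      = mellin (fun r : ℝ => (r : ℂ) ^ (1 : ℂ) •
          (exp (-(a * r)) / (1 - exp (-(r : ℂ))))) s := by
        refine setIntegral_congr_fun measurableSet_Ioi fun r _ => ?_
        simp only [bernoulliKernel, cpow_one, smul_eq_mul]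
        rw [← neg_div_neg_eq, neg_sub, neg_mul, neg_neg, mul_neg, mul_div_assoc]
    _ = Gamma (s + 1) * ∑' k : ℕ, 1 / ((k : ℂ) + a) ^ (s + 1) := by
        rw [mellin_cpow_smul, ← hmellin.tsum_eq, ← tsum_mul_left]
        simp only [mul_one_div, mul_one, ofReal_add, ofReal_natCast]

theorem mellin_psiKernel_of_one_lt_re (ha : 0 < a) {s : ℂ} (hs : 1 < s.re) :
    mellin (fun r : ℝ => psiKernel a (-(r : ℂ))) s =
      Gamma s * ((s - 1) * ∑' k : ℕ, 1 / ((k : ℂ) + a) ^ s) := by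
  have hB := hankelAdmissible_bernoulliKernel ha
  have hpsi := (hankelAdmissible_psiKernel ha).mellinConvergent (zero_lt_one.trans hs)
  have hderiv (r : ℝ) (hr : 0 < r) :
      HasDerivAt (fun r : ℝ => bernoulliKernel a (-(r : ℂ))) ((-1 : ℂ) • psiKernel a (-(r : ℂ)))
        r := by
    have hexp : exp (-(r : ℂ)) ≠ 1 := exp_ne_one_of_abs_im_lt (by simpa using hr.ne')
      (by simpa using Real.pi_pos)
    rw [smul_eq_mul, mul_comm]
    exact (hasDerivAt_bernoulliKernel a hexp).comp r (hasDerivAt_id r).ofReal_comp.neg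
  have hparts := mellin_deriv_of_isBigO hB.pos hderiv hB.decay hB.isBigO_nhdsGT_zero
    (by linarith) (hpsi.const_smul (-1 : ℂ))
  rw [mellin_const_smul, mellin_bernoulliKernel ha (by rw [sub_re, one_re]; linarith),
    sub_add_cancel, smul_eq_mul] at hparts
  linear_combination -hparts

end Kernels

section Interpolation

variable {a : ℝ} {Z : ℂ → ℂ} {s : ℂ}

theorem hasSum_mellin_altKernel (ha : 0 < a) (hs : 0 < s.re) :
    HasSum (fun n => mellin (fun r : ℝ => altCoeff a n * altKernel a n (-(r : ℂ))) s)
      (mellin (fun r : ℝ => psiKernel a (-(r : ℂ))) s) :=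
  hasSum_mellin_of_norm_sum_le
    (fun n => (hankelAdmissible_const_mul_altKernel ha (altCoeff a n) n 1).continuousOn)
    ((hankelAdmissible_expMajorant ha _ 1).mellinConvergent hs)
    (fun _ hr => norm_sum_mul_altKernel_le_expMajorant (by positivity) (norm_altCoeff_le a) a
      (neg_ofReal_mem_expansionRegion hr))
    (fun _ hr => hasSum_psiKernel a (neg_ofReal_mem_expansionRegion hr))

theorem hasSum_hankelIntegral_altKernel (ha : 0 < a) (s : ℂ) :
    HasSum (fun n => hankelIntegral (fun t => altCoeff a n * altKernel a n t) s (1 / 4))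
      (hankelIntegral (psiKernel a) s (1 / 4)) :=
  hasSum_hankelIntegral_of_norm_sum_le (by norm_num)
    (fun n => ((differentiable_altKernel a n).continuous.const_mul _).continuousOn)
    ((hankelAdmissible_expMajorant ha _ 1).hankelIntegrable (by norm_num) (by norm_num) s)
    (fun _ ht => norm_sum_mul_altKernel_le_expMajorant (by positivity) (norm_altCoeff_le a) a
      (hankelPath_subset_expansionRegion ht))
    (fun _ ht => hasSum_psiKernel a (hankelPath_subset_expansionRegion ht))

theorem hankelIntegral_const_mul_altKernel (ha : 0 < a) (c : ℂ) (n : ℕ) {ε : ℝ} (hε : 0 < ε)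
    (s : ℂ) : hankelIntegral (fun t => c * altKernel a n t) s ε =
      2 * Real.pi * I * (altSum (n + 1) s a * c) / Gamma (1 - s) :=
  (hankelAdmissible_const_mul_altKernel ha c n (ε + 1)).hankelIntegral_eq_div_Gamma hε
    (lt_add_one ε) ((differentiable_altSum ha (n + 1)).mul_const c)
    (fun _ hz => mellin_const_mul_altKernel ha c n hz) s

theorem mellin_psiKernel (ha : 0 < a) (hZ : Differentiable ℂ Z)
    (hZs : ∀ s : ℂ, 1 < s.re → Z s = (s - 1) * ∑' n : ℕ, 1 / ((n : ℂ) + a) ^ s)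
    (hs : 0 < s.re) : mellin (fun r : ℝ => psiKernel a (-(r : ℂ))) s = Gamma s * Z s :=
  (hankelAdmissible_psiKernel ha).mellin_eq_Gamma_mul hZ
    (fun z hz => hZs z hz ▸ mellin_psiKernel_of_one_lt_re ha hz) hs hs

theorem hankelIntegral_psiKernel (ha : 0 < a) (hZ : Differentiable ℂ Z)
    (hZs : ∀ s : ℂ, 1 < s.re → Z s = (s - 1) * ∑' n : ℕ, 1 / ((n : ℂ) + a) ^ s)
    {ε : ℝ} (hε : 0 < ε) (hε2 : ε < 2 * Real.pi) (s : ℂ) :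
    hankelIntegral (psiKernel a) s ε = 2 * Real.pi * I * Z s / Gamma (1 - s) :=
  (hankelAdmissible_psiKernel ha).hankelIntegral_eq_div_Gamma hε hε2 hZ
    (fun z hz => hZs z hz ▸ mellin_psiKernel_of_one_lt_re ha hz) s

theorem hankelRepr_eq (ha : 0 < a) (hZ : Differentiable ℂ Z)
    (hZs : ∀ s : ℂ, 1 < s.re → Z s = (s - 1) * ∑' n : ℕ, 1 / ((n : ℂ) + a) ^ s)
    {ε : ℝ} (hε : 0 < ε) (hε2 : ε < 2 * Real.pi) (hs : ∀ m : ℕ, s ≠ (m : ℂ) + 1) :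
    hankelRepr a ε s = Z s := by
  have hGamma : Gamma (1 - s) ≠ 0 := Gamma_ne_zero fun m hm => hs m (by linear_combination -hm)
  calc hankelRepr a ε s
      = Gamma (1 - s) / (2 * Real.pi * I) * hankelIntegral (psiKernel a) s ε := rfl
    _ = Z s := by
        rw [hankelIntegral_psiKernel ha hZ hZs hε hε2]
        field_simp [two_pi_I_ne_zero]

theorem eventually_ne_natCast (m : ℕ) : ∀ᶠ s : ℂ in 𝓝[≠] (m : ℂ), ∀ k : ℕ, s ≠ k := by
  have hclosed : IsClosed ((Nat.cast : ℕ → ℂ) '' {m}ᶜ) :=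
    (isometry_ofReal.isClosedEmbedding.comp Nat.isClosedEmbedding_coe_real).isClosedMap _
      (isClosed_discrete _)
  filter_upwards [self_mem_nhdsWithin, nhdsWithin_le_nhds (hclosed.isOpen_compl.mem_nhds
    (fun ⟨k, hk, hkm⟩ => hk (Nat.cast_injective hkm)))] with s hsm hs k hk
  exact hs ⟨k, fun hkm => hsm (hkm ▸ hk), hk.symm⟩

theorem tendsto_hankelRepr (ha : 0 < a) (hZ : Differentiable ℂ Z)
    (hZs : ∀ s : ℂ, 1 < s.re → Z s = (s - 1) * ∑' n : ℕ, 1 / ((n : ℂ) + a) ^ s)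
    {ε : ℝ} (hε : 0 < ε) (hε2 : ε < 2 * Real.pi) (m : ℕ) :
    Tendsto (hankelRepr a ε) (𝓝[≠] ((m : ℂ) + 1)) (𝓝 (Z ((m : ℂ) + 1))) :=
  ((hZ.continuous.tendsto _).mono_left nhdsWithin_le_nhds).congr' <|
    Eventually.mono (by exact_mod_cast eventually_ne_natCast (m + 1)) fun _ hs =>
      (hankelRepr_eq ha hZ hZs hε hε2 fun k => by exact_mod_cast hs (k + 1)).symm

theorem hasSum_altSum_mul_altCoeff (ha : 0 < a) (hZ : Differentiable ℂ Z)
    (hZs : ∀ s : ℂ, 1 < s.re → Z s = (s - 1) * ∑' n : ℕ, 1 / ((n : ℂ) + a) ^ s) (s : ℂ) :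
    HasSum (fun n => altSum (n + 1) s a * altCoeff a n) (Z s) := by
  rcases lt_or_ge 0 s.re with hs | hs
  · have hsum := hasSum_mellin_altKernel ha hs
    simp only [mellin_const_mul_altKernel ha _ _ hs, mellin_psiKernel ha hZ hZs hs] at hsum
    exact (hasSum_mul_left_iff (Gamma_ne_zero_of_re_pos hs)).1 hsum
  · have hGamma : Gamma (1 - s) ≠ 0 := Gamma_ne_zero_of_re_pos <| by
      rw [sub_re, one_re]
      linarith
    have hsum := hasSum_hankelIntegral_altKernel ha s
    simp only [hankelIntegral_const_mul_altKernel ha _ _ (by norm_num : (0 : ℝ) < 1 / 4),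
      hankelIntegral_psiKernel ha hZ hZs (by norm_num : (0 : ℝ) < 1 / 4)
        (by linarith [Real.pi_gt_three]), mul_div_right_comm (2 * (Real.pi : ℂ) * I)] at hsum
    exact (hasSum_mul_left_iff (div_ne_zero two_pi_I_ne_zero hGamma)).1 hsum

end Interpolation

theorem corollary1_general {a : ℝ} (ha : 0 < a) {Z : ℂ → ℂ} (hZ : Differentiable ℂ Z)
    (hZs : ∀ s : ℂ, 1 < s.re → Z s = (s - 1) * ∑' n : ℕ, 1 / ((n : ℂ) + a) ^ s) :
    (∀ ε : ℝ, 0 < ε → ε < 2 * Real.pi →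
      (∀ s : ℂ, HankelIntegrable (fun t => psiFun a (-t) * exp (((a : ℂ) - 1) * t)) s ε) ∧
      (∀ s : ℂ, (∀ m : ℕ, s ≠ (m : ℂ) + 1) → Z s = hankelRepr a ε s) ∧
      (∀ m : ℕ, Tendsto (hankelRepr a ε) (𝓝[≠] ((m : ℂ) + 1)) (𝓝 (Z ((m : ℂ) + 1))))) ∧
    (∀ s : ℂ, HasSum
      (fun n : ℕ => altSum (n + 1) s a *
        (1 / (((n + 1 : ℕ) : ℂ) + 1) + ((a : ℂ) - 1) / ((n + 1 : ℕ) : ℂ))) (Z s)) :=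
  ⟨fun _ hε hε2 =>
    ⟨(hankelAdmissible_psiKernel ha).hankelIntegrable hε hε2,
      fun _ hs => (hankelRepr_eq ha hZ hZs hε hε2 hs).symm,
      tendsto_hankelRepr ha hZ hZs hε hε2⟩,
    hasSum_altSum_mul_altCoeff ha hZ hZs⟩

theorem corollary1 (a : ℝ) (ha : 0 < a) (ha1 : a ≤ 1) :
    -- (C): the contour integral converges for every `s`; the representation is an equality when
    -- `s` is not a pole of `Γ(1 - s)`, and holds as a limit when `s` is one of these poles
    (∀ ε : ℝ, 0 < ε → ε < 2 * Real.pi →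
      (∀ s : ℂ,
        HankelIntegrable (fun t => psiFun a (-t) * Complex.exp (((a : ℂ) - 1) * t)) s ε) ∧
      (∀ s : ℂ, (∀ m : ℕ, s ≠ (m : ℂ) + 1) → subOneMulHurwitz a s = hankelRepr a ε s) ∧
      (∀ m : ℕ, Tendsto (hankelRepr a ε) (𝓝[≠] ((m : ℂ) + 1))
        (𝓝 (subOneMulHurwitz a ((m : ℂ) + 1))))) ∧
    -- (D): the series over `n + 1 = 1, 2, 3, …`
    (∀ s : ℂ, HasSum
      (fun n : ℕ => altSum (n + 1) s a *
        (1 / (((n + 1 : ℕ) : ℂ) + 1) + ((a : ℂ) - 1) / ((n + 1 : ℕ) : ℂ)))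
      (subOneMulHurwitz a s)) :=
  corollary1_general ha (differentiable_subOneMulHurwitz a) fun _ hs =>
    subOneMulHurwitz_of_one_lt_re ha ha1 hs
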